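/- Let $(X,d)$ be a compact metric space, let $1\le p<\infty$, and let $\mu$ be a Borel probability measure on $X$. Write $\mathcal{P}(X)$ for the set of Borel probability measures on $X$ and $\mathrm{K}(X)$ for the set of non-empty compact subsets of $X$. For $\nu\in\mathcal{P}(X)$ let \[ F_p(\nu)=\underset{x\in X}{\arg\min}\int_X d^p(x,y)\,d\nu(y)\in\mathrm{K}(X) \] be the Fréchet $p$-mean of $\nu$, and let $H(\nu\,|\,\mu)=\int_X\log\frac{d\nu}{d\mu}\,d\nu$ if $\nu\ll\mu$ and $H(\nu\,|\,\mu)=\infty$ otherwise. For $C,C'\in\mathrm{K}(X)$ let $\rho(C,C')=\max_{x\in C}\min_{x'\in C'}d(x,x')$, and let $\tau_H^+$ be the topology on $\mathrm{K}(X)$ in which a net $(C_\alpha)$ converges to $C$ if and only if $\rho(C_\alpha,C)\to0$. Let $Y_1,Y_2,\dots$ be i.i.d. random elements of $X$ with law $\mu$, defined on a probability space $(\Omega,\mathcal{F},\mathbb{P})$, and let $\bar\mu_n=\frac1n\sum_{i=1}^n\delta_{Y_i}$ for $n\ge1$. Then the function $I_{p,\mu}:(\mathrm{K}(X),\tau_H^+)\to[0,\infty]$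 defined by \[ I_{p,\mu}(C)=\inf\{H(\nu\,|\,\mu):\nu\in\mathcal{P}(X),\ F_p(\nu)\supseteq C\}\qquad(\inf\emptyset=\infty) \] has compact sublevel sets $\{C\in\mathrm{K}(X): I_{p,\mu}(C)\le\alpha\}$, and for every Borel set $A$ of $(\mathrm{K}(X),\tau_H^+)$, with closure $\bar A$ in $\tau_H^+$, \[ \limsup_{n\to\infty}\frac1n\log\mathbb{P}\{F_p(\bar\mu_n)\in A\}\le-\inf\{I_{p,\mu}(C):C\in\bar A\}\qquad(\log 0=-\infty). \] Consequently, for every $\varepsilon>0$ there exist constants $c_1,c_2>0$, depending only on $(X,d)$, $\mu$, $p$ and $\varepsilon$, such that $\mathbb{P}\{\rho(F_p(\bar\mu_n),F_p(\mu))\ge\varepsilon\}\le c_1e^{-c_2n}$ for all $n\ge1$. -/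

import Mathlib

open MeasureTheory ProbabilityTheory Filter Topology Set
open scoped ENNReal

namespace FrechetLDP

/-- The set `K(X)` of non-empty compact subsets of `X`. This is a synonym of Mathlib's
`NonemptyCompacts X`, made so as not to inherit its (two-sided) Hausdorff topology: below it is
given the Hausdorff upper topology. -/
def HyperK (X : Type*) [TopologicalSpace X] : Type _ := TopologicalSpace.NonemptyCompacts X

instance (X : Type*) [TopologicalSpace X] : SetLike (HyperK X) X :=
  inferInstanceAs (SetLike (TopologicalSpace.NonemptyCompacts X) X)

section Hyperspace

variable {X : Type*} [MetricSpace X]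

theorem HyperK.isCompact (C : HyperK X) : IsCompact (C : Set X) :=
  TopologicalSpace.NonemptyCompacts.isCompact C

theorem HyperK.nonempty (C : HyperK X) : (C : Set X).Nonempty :=
  TopologicalSpace.NonemptyCompacts.nonempty C

/-- The one-sided Hausdorff distance `ρ(C, C') = max_{x ∈ C} min_{x' ∈ C'} d(x, x')`.
The extrema are attained because `C`, `C'` are compact and non-empty, so the supremum and the
infimum (in `Metric.infDist`) are a maximum and a minimum. -/
noncomputable def rho (C C' : HyperK X) : ℝ :=
  sSup ((fun x => Metric.infDist x (C' : Set X)) '' (C : Set X))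

theorem infDist_le_rho {C C' : HyperK X} {x : X} (hx : x ∈ (C : Set X)) :
    Metric.infDist x (C' : Set X) ≤ rho C C' :=
  le_csSup ((C.isCompact.image (Metric.continuous_infDist_pt _)).bddAbove)
    (mem_image_of_mem _ hx)

theorem rho_nonneg (C C' : HyperK X) : 0 ≤ rho C C' := by
  obtain ⟨x, hx⟩ := C.nonempty
  exact Metric.infDist_nonneg.trans (infDist_le_rho hx)

theorem rho_self (C : HyperK X) : rho C C = 0 := by
  refine le_antisymm (csSup_le (C.nonempty.image _) ?_) (rho_nonneg C C)
  rintro _ ⟨x, hx, rfl⟩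
  exact (Metric.infDist_zero_of_mem hx).le

theorem rho_triangle (C C' C'' : HyperK X) : rho C C'' ≤ rho C C' + rho C' C'' := by
  refine csSup_le (C.nonempty.image _) ?_
  rintro _ ⟨x, hx, rfl⟩
  obtain ⟨y, hy, hxy⟩ := C'.isCompact.exists_infDist_eq_dist C'.nonempty x
  have h1 : Metric.infDist x (C' : Set X) ≤ rho C C' := infDist_le_rho hx
  have h2 : Metric.infDist y (C'' : Set X) ≤ rho C' C'' := infDist_le_rho hy
  have h3 : Metric.infDist x (C'' : Set X) ≤ Metric.infDist y (C'' : Set X) + dist x y :=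
    Metric.infDist_le_infDist_add_dist
  simp only
  linarith

/-- The Hausdorff upper topology `τ_H⁺` on `K(X)`: a set is open if and only if around each of its
points `C` it contains some ball `{C' : ρ(C', C) < ε}`. See `tendsto_nhds_iff_rho`. -/
instance hausdorffUpper : TopologicalSpace (HyperK X) where
  IsOpen U := ∀ C ∈ U, ∃ ε : ℝ, 0 < ε ∧ ∀ C' : HyperK X, rho C' C < ε → C' ∈ U
  isOpen_univ := fun _ _ => ⟨1, one_pos, fun _ _ => mem_univ _⟩
  isOpen_inter := by
    rintro U V hU hV C ⟨hCU, hCV⟩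
    obtain ⟨a, ha, hU⟩ := hU C hCU
    obtain ⟨b, hb, hV⟩ := hV C hCV
    exact ⟨min a b, lt_min ha hb, fun C' h =>
      ⟨hU C' (h.trans_le (min_le_left _ _)), hV C' (h.trans_le (min_le_right _ _))⟩⟩
  isOpen_sUnion := by
    rintro S hS C ⟨U, hUS, hCU⟩
    obtain ⟨a, ha, hU⟩ := hS U hUS C hCU
    exact ⟨a, ha, fun C' h => ⟨U, hUS, hU C' h⟩⟩

theorem isOpen_rho_ball (C : HyperK X) (ε : ℝ) : IsOpen {C' : HyperK X | rho C' C < ε} := by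
  intro C' hC'
  refine ⟨ε - rho C' C, sub_pos.2 hC', fun C'' h => ?_⟩
  have := rho_triangle C'' C' C
  change rho C'' C < ε
  linarith

/-- Convergence `C_α → C` in `τ_H⁺` means `ρ(C_α, C) → 0`, for nets as well as for sequences.
This property characterizes the topology. -/
theorem tendsto_nhds_iff_rho {ι : Type*} {l : Filter ι} {u : ι → HyperK X} {C : HyperK X} :
    Tendsto u l (𝓝 C) ↔ Tendsto (fun i => rho (u i) C) l (𝓝 0) := by
  constructor
  · intro h
    refine tendsto_order.2 ⟨fun a ha => Eventually.of_forall fun i =>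
      ha.trans_le (rho_nonneg _ _), fun a ha => ?_⟩
    exact h.eventually ((isOpen_rho_ball C a).mem_nhds (by simpa [rho_self] using ha))
  · intro h
    refine tendsto_nhds.2 fun U hU hCU => ?_
    obtain ⟨a, ha, hU⟩ := hU C hCU
    filter_upwards [h.eventually (gt_mem_nhds ha)] with i hi
    exact hU _ hi

end Hyperspace

section Frechet

variable {X : Type*} [MetricSpace X] [MeasurableSpace X]

/-- `f_p(ν, x) = ∫ d(x, y)^p dν(y)`. -/
noncomputable def frechetFun (p : ℝ) (ν : Measure X) (x : X) : ℝ :=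
  ∫ y, dist x y ^ p ∂ν

/-- The Fréchet `p`-mean of `ν` as a set: all the global minimizers of `f_p(ν, ·)`. -/
def frechetSet (p : ℝ) (ν : Measure X) : Set X :=
  {x | ∀ x', frechetFun p ν x ≤ frechetFun p ν x'}

variable [BorelSpace X] [CompactSpace X]

theorem continuous_frechetFun {p : ℝ} (hp : 1 ≤ p) (ν : Measure X) [IsFiniteMeasure ν] :
    Continuous (frechetFun p ν) := by
  have hf : Continuous (Function.uncurry fun x y : X => dist x y ^ p) :=
    continuous_dist.rpow_const fun _ => Or.inr (zero_le_one.trans hp)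
  have h := continuous_parametric_integral_of_continuous (μ := ν) hf (isCompact_univ (X := X))
  simp only [Measure.restrict_univ] at h
  exact h

/-- On a compact space, the Fréchet `p`-mean `F_p(ν)` of a probability measure, as an element of
`K(X)`. -/
def frechetMean (p : ℝ) (hp : 1 ≤ p) (ν : ProbabilityMeasure X) : HyperK X :=
  { carrier := frechetSet p (ν : Measure X)
    isCompact' := by
      have h : frechetSet p (ν : Measure X) =
          ⋂ x', {x | frechetFun p (ν : Measure X) x ≤ frechetFun p (ν : Measure X) x'} := by
        ext x; simp [frechetSet]
      rw [h]
      exact (isClosed_iInter fun x' =>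
        isClosed_le (continuous_frechetFun hp _) continuous_const).isCompact
    nonempty' := by
      have : Nonempty X := ν.nonempty
      obtain ⟨x, -, hx⟩ := isCompact_univ.exists_isMinOn univ_nonempty
        (continuous_frechetFun hp (ν : Measure X)).continuousOn
      exact ⟨x, fun x' => hx (mem_univ x')⟩ }

/-- `I_{p,μ}(C) = inf {H(ν | μ) : ν ∈ P(X), F_p(ν) ⊇ C}`, an element of `[0, ∞]` (the infimum of the
empty set is `∞`). For probability measures Mathlib's Kullback–Leibler divergence `klDiv ν μ` is the
relative entropy `H(ν | μ)`. -/
noncomputable def rateFun (p : ℝ) (hp : 1 ≤ p) (μ : ProbabilityMeasure X) (C : HyperK X) : ℝ≥0∞ :=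
  ⨅ (ν : ProbabilityMeasure X) (_ : (C : Set X) ⊆ (frechetMean p hp ν : Set X)),
    InformationTheory.klDiv (ν : Measure X) (μ : Measure X)

end Frechet

/-- The empirical measure `(1/n) ∑ δ_{y_i}` of the first `n` terms `y 0, …, y (n - 1)`, `n ≥ 1`. -/
noncomputable def empirical {X : Type*} [MeasurableSpace X] (n : ℕ+) (y : ℕ → X) :
    ProbabilityMeasure X :=
  ⟨((n : ℕ) : ℝ≥0∞)⁻¹ • ∑ i ∈ Finset.range n, Measure.dirac (y i), ⟨by
    simp [ENNReal.inv_mul_cancel]⟩⟩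

/-- `Y 0, Y 1, …` are i.i.d. random elements of `X` with law `μ`, on the probability space
`(Ω, P)`. -/
structure IsIIDSample {Ω X : Type*} [MeasurableSpace Ω] [MeasurableSpace X]
    (P : Measure Ω) (μ : ProbabilityMeasure X) (Y : ℕ → Ω → X) : Prop where
  measurable : ∀ i, Measurable (Y i)
  indep : iIndepFun Y P
  law : ∀ i, P.map (Y i) = (μ : Measure X)

end FrechetLDP

open FrechetLDP

/-! The argument rests on two facts. First, the Donsker–Varadhan formula writes `klDiv · μ` as a
supremum of weakly continuous functionals `ν ↦ ∫ f dν - ∫ (e^f - 1) dμ`, so it is lower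
semicontinuous; Chernoff's bound applies to each functional evaluated at the empirical measure, and
a finite covering turns this into Sanov's upper bound for compact sets of measures, with constants
that do not depend on the sample. Secondly, the Fréchet mean has closed graph, hence it is
continuous from the weak topology to the Hausdorff upper topology, and Sanov's bound is transferred
along it. A set `C` has rate at most `α` if and only if it is contained in the Fréchet mean of a
measure of entropy at most `α`; the sublevel sets are therefore compact because the measures of
entropy at most `α` are, and because open sets of the upper topology are stable under passing to
subsets. -/

namespace FrechetLDP

open InformationTheory Real
open scoped BoundedContinuousFunction NNReal

/-! ### The Donsker–Varadhan formula -/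

section TruncatedLogarithm

theorem mul_sub_exp_sub_one_le_klFun {g : ℝ} (hg : 0 ≤ g) (t : ℝ) :
    g * t - (exp t - 1) ≤ klFun g := by
  rw [klFun_apply]
  rcases hg.eq_or_lt with rfl | hg
  · simp [(exp_pos t).le]
  · have h := add_one_le_exp (t - log g)
    rw [exp_sub, exp_log hg, le_div_iff₀ hg] at h
    linarith

/-- The logarithm truncated to `[-k, k]`. The truncation takes place inside the logarithm, so that
the value at `0` is `-k` and not the junk value `log 0 = 0`. -/
noncomputable def truncLog (k g : ℝ) : ℝ :=
  log (max (exp (-k)) (min (exp k) g))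

theorem exp_truncLog (k g : ℝ) : exp (truncLog k g) = max (exp (-k)) (min (exp k) g) :=
  exp_log (lt_max_of_lt_left (exp_pos _))

theorem measurable_truncLog (k : ℝ) : Measurable (truncLog k) :=
  measurable_log.comp (by fun_prop)

theorem abs_truncLog_le {k : ℝ} (hk : 0 ≤ k) (g : ℝ) : |truncLog k g| ≤ k := by
  rw [abs_le, ← exp_le_exp, ← exp_le_exp (x := truncLog k g), exp_truncLog]
  exact ⟨le_max_left _ _, max_le (exp_le_exp.2 (by linarith)) (min_le_left _ _)⟩

/-- The concave function `t ↦ g * t - (exp t - 1)` vanishes at `0` and is maximal at `log g`, and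
`truncLog k g` lies between these two points. -/
theorem mul_truncLog_sub_exp_sub_one_nonneg {k : ℝ} (hk : 0 ≤ k) (g : ℝ) :
    0 ≤ g * truncLog k g - (exp (truncLog k g) - 1) := by
  set t := truncLog k g
  have h_exp : exp t = max (exp (-k)) (min (exp k) g) := exp_truncLog k g
  have h_kl : 0 ≤ exp t * t + 1 - exp t := by
    simpa [klFun_apply] using klFun_nonneg (exp_pos t).le
  have h_sign : 0 ≤ (g - exp t) * t := by
    rcases le_total 1 g with h1g | hg1
    · have h_le : exp t ≤ g :=
        h_exp ▸ max_le ((exp_le_one_iff.2 (by linarith)).trans h1g) (min_le_right _ _)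
      have h_one : 1 ≤ exp t := h_exp ▸ le_max_of_le_right (le_min (one_le_exp hk) h1g)
      exact mul_nonneg (sub_nonneg.2 h_le) (one_le_exp_iff.1 h_one)
    · have h_le : g ≤ exp t := by
        rw [h_exp, min_eq_right (hg1.trans (one_le_exp hk))]
        exact le_max_right _ _
      have h_one : exp t ≤ 1 :=
        h_exp ▸ max_le (exp_le_one_iff.2 (by linarith)) ((min_le_right _ _).trans hg1)
      exact mul_nonneg_of_nonpos_of_nonpos (sub_nonpos.2 h_le) (exp_le_one_iff.1 h_one)
  linarith

theorem tendsto_exp_truncLog {g : ℝ} (hg : 0 ≤ g) :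
    Tendsto (fun k => exp (truncLog k g)) atTop (𝓝 g) := by
  have h_min : Tendsto (fun k => min (exp k) g) atTop (𝓝 g) := by
    refine tendsto_const_nhds.congr' ?_
    filter_upwards [tendsto_exp_atTop.eventually_ge_atTop g] with k hk
    rw [min_eq_right hk]
  have h_exp_neg : Tendsto (fun k => exp (-k)) atTop (𝓝 0) :=
    tendsto_exp_atBot.comp tendsto_neg_atTop_atBot
  simpa only [exp_truncLog, max_eq_right hg] using h_exp_neg.max h_min

theorem tendsto_mul_truncLog_sub_exp_sub_one {g : ℝ} (hg : 0 ≤ g) :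
    Tendsto (fun k => g * truncLog k g - (exp (truncLog k g) - 1)) atTop (𝓝 (klFun g)) := by
  have h_exp := tendsto_exp_truncLog hg
  have h_mul : Tendsto (fun k => g * truncLog k g) atTop (𝓝 (g * log g)) := by
    rcases hg.eq_or_lt with rfl | hg
    · simp
    · simpa only [log_exp] using (h_exp.log hg.ne').const_mul g
  convert h_mul.sub (h_exp.sub_const 1) using 2
  rw [klFun_apply]
  ring

end TruncatedLogarithm

section DonskerVaradhan

variable {X : Type*} [MeasurableSpace X]

/-- The functional of the Donsker–Varadhan formula: the relative entropy `klDiv ν μ` of finite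
measures is its supremum over `f`. Subtracting `1` from the exponential accounts for measures of
different masses. -/
noncomputable def entropyDual (ν μ : Measure X) (f : X → ℝ) : ℝ :=
  ∫ x, f x ∂ν - ∫ x, (exp (f x) - 1) ∂μ

variable {ν μ : Measure X} [IsFiniteMeasure ν] {f : X → ℝ}

theorem integrable_exp_of_abs_le {M : ℝ} (hf : AEStronglyMeasurable f ν)
    (hM : ∀ x, |f x| ≤ M) : Integrable (fun x => exp (f x)) ν :=
  .of_bound (continuous_exp.comp_aestronglyMeasurable hf) (exp M) <| ae_of_all _ fun x => by
    rw [norm_eq_abs, abs_exp, exp_le_exp]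
    exact (abs_le.1 (hM x)).2

/-- Otherwise the functions `k • 1_s`, where `s` is `μ`-null but not `ν`-null, give arbitrarily
large values of `entropyDual`. -/
theorem absolutelyContinuous_of_forall_entropyDual_le {c : ℝ≥0∞} (hc : c ≠ ∞)
    (h : ∀ (f : X → ℝ) (M : ℝ), Measurable f → (∀ x, |f x| ≤ M) →
      ENNReal.ofReal (entropyDual ν μ f) ≤ c) : ν ≪ μ := by
  refine Measure.AbsolutelyContinuous.mk fun s hs hμs => ?_
  by_contra hνs
  have hpos : 0 < ν.real s := ENNReal.toReal_pos hνs (measure_ne_top _ _)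
  obtain ⟨k, hk⟩ := exists_nat_gt (c.toReal / ν.real s)
  have h_dual : entropyDual ν μ (s.indicator fun _ => (k : ℝ)) = ν.real s * k := by
    have h_exp : ∫ x, (exp (s.indicator (fun _ => (k : ℝ)) x) - 1) ∂μ = 0 := by
      refine integral_eq_zero_of_ae ?_
      filter_upwards [measure_eq_zero_iff_ae_notMem.1 hμs] with x hx
      simp [hx]
    rw [entropyDual, h_exp, integral_indicator_const _ hs, smul_eq_mul, sub_zero]
  have h_le := h (s.indicator fun _ => (k : ℝ)) k (measurable_const.indicator hs) fun x => by
    by_cases hx : x ∈ s <;> simp [hx]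
  rw [h_dual, ENNReal.ofReal_le_iff_le_toReal hc] at h_le
  rw [div_lt_iff₀' hpos] at hk
  linarith

variable [IsFiniteMeasure μ]

theorem integrable_rnDeriv_mul_sub_exp_sub_one (h_ac : ν ≪ μ) (hf : Integrable f ν)
    (hexp : Integrable (fun x => exp (f x)) μ) :
    Integrable (fun x => (ν.rnDeriv μ x).toReal * f x - (exp (f x) - 1)) μ :=
  ((integrable_toReal_rnDeriv_mul_iff h_ac).2 hf).sub (hexp.sub (integrable_const 1))

theorem entropyDual_eq_integral_rnDeriv (h_ac : ν ≪ μ) (hf : Integrable f ν)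
    (hexp : Integrable (fun x => exp (f x)) μ) :
    entropyDual ν μ f = ∫ x, ((ν.rnDeriv μ x).toReal * f x - (exp (f x) - 1)) ∂μ := by
  have hexp' : Integrable (fun x => exp (f x) - 1) μ := hexp.sub (integrable_const 1)
  rw [integral_sub ((integrable_toReal_rnDeriv_mul_iff h_ac).2 hf) hexp',
    integral_toReal_rnDeriv_mul h_ac, entropyDual]

theorem ofReal_entropyDual_le_klDiv (hf : Integrable f ν)
    (hexp : Integrable (fun x => exp (f x)) μ) :
    ENNReal.ofReal (entropyDual ν μ f) ≤ klDiv ν μ := by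
  by_cases h_top : klDiv ν μ = ∞
  · simp [h_top]
  obtain ⟨h_ac, h_llr⟩ := klDiv_ne_top_iff.1 h_top
  rw [← ENNReal.ofReal_toReal h_top, toReal_klDiv_eq_integral_klFun h_ac,
    entropyDual_eq_integral_rnDeriv h_ac hf hexp]
  exact ENNReal.ofReal_le_ofReal <| integral_mono
    (integrable_rnDeriv_mul_sub_exp_sub_one h_ac hf hexp)
    ((integrable_klFun_rnDeriv_iff h_ac).2 h_llr)
    fun x => mul_sub_exp_sub_one_le_klFun ENNReal.toReal_nonneg _

/-- Fatou's lemma along the truncations of the maximizer `log (dν/dμ)`. -/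
theorem klDiv_le_of_forall_bounded_entropyDual_le {c : ℝ≥0∞}
    (h : ∀ (f : X → ℝ) (M : ℝ), Measurable f → (∀ x, |f x| ≤ M) →
      ENNReal.ofReal (entropyDual ν μ f) ≤ c) : klDiv ν μ ≤ c := by
  rcases eq_or_ne c ∞ with rfl | hc
  · exact le_top
  have h_ac : ν ≪ μ := absolutelyContinuous_of_forall_entropyDual_le hc h
  rw [klDiv_eq_lintegral_klFun_of_ac h_ac]
  let g : X → ℝ := fun x => (ν.rnDeriv μ x).toReal
  have hg : Measurable g := (Measure.measurable_rnDeriv ν μ).ennreal_toReal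
  let f : ℕ → X → ℝ := fun k x => truncLog k (g x)
  have hf_meas (k : ℕ) : Measurable (f k) := (measurable_truncLog k).comp hg
  have hf_bdd (k : ℕ) (x : X) : |f k x| ≤ k := abs_truncLog_le k.cast_nonneg _
  let φ : ℕ → X → ℝ := fun k x => g x * f k x - (exp (f k x) - 1)
  have hφ_le (k : ℕ) : ∫⁻ x, ENNReal.ofReal (φ k x) ∂μ ≤ c := by
    have hfν : Integrable (f k) ν :=
      .of_bound (hf_meas k).aestronglyMeasurable k (ae_of_all _ (hf_bdd k))
    have hexp : Integrable (fun x => exp (f k x)) μ :=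
      integrable_exp_of_abs_le (hf_meas k).aestronglyMeasurable (hf_bdd k)
    rw [← ofReal_integral_eq_lintegral_ofReal
        (integrable_rnDeriv_mul_sub_exp_sub_one h_ac hfν hexp)
        (ae_of_all _ fun x => mul_truncLog_sub_exp_sub_one_nonneg k.cast_nonneg _),
      ← entropyDual_eq_integral_rnDeriv h_ac hfν hexp]
    exact h _ _ (hf_meas k) (hf_bdd k)
  have hφ_tendsto (x : X) :
      Tendsto (fun k => ENNReal.ofReal (φ k x)) atTop (𝓝 (ENNReal.ofReal (klFun (g x)))) :=
    ENNReal.tendsto_ofReal <| (tendsto_mul_truncLog_sub_exp_sub_one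
      ENNReal.toReal_nonneg).comp tendsto_natCast_atTop_atTop
  calc ∫⁻ x, ENNReal.ofReal (klFun (g x)) ∂μ
      = ∫⁻ x, liminf (fun k => ENNReal.ofReal (φ k x)) atTop ∂μ :=
        lintegral_congr fun x => (hφ_tendsto x).liminf_eq.symm
    _ ≤ liminf (fun k => ∫⁻ x, ENNReal.ofReal (φ k x) ∂μ) atTop :=
        lintegral_liminf_le fun k => by fun_prop
    _ ≤ c := liminf_le_of_frequently_le' (Frequently.of_forall hφ_le)

theorem tendsto_entropyDual_of_tendsto_ae {F : ℕ → X → ℝ} {M : ℝ}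
    (hF : ∀ n, Measurable (F n)) (hM : ∀ n x, |F n x| ≤ M)
    (hν : ∀ᵐ x ∂ν, Tendsto (fun n => F n x) atTop (𝓝 (f x)))
    (hμ : ∀ᵐ x ∂μ, Tendsto (fun n => F n x) atTop (𝓝 (f x))) :
    Tendsto (fun n => entropyDual ν μ (F n)) atTop (𝓝 (entropyDual ν μ f)) := by
  refine .sub ?_ ?_
  · exact tendsto_integral_of_dominated_convergence (fun _ => M)
      (fun n => (hF n).aestronglyMeasurable) (integrable_const M)
      (fun n => ae_of_all _ (hM n)) hν
  · refine tendsto_integral_of_dominated_convergence (fun _ => exp M + 1)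
      (fun n => ((measurable_exp.comp (hF n)).sub_const 1).aestronglyMeasurable)
      (integrable_const _) (fun n => ae_of_all _ fun x => ?_) ?_
    · have h_exp : exp (F n x) ≤ exp M := exp_le_exp.2 (abs_le.1 (hM n x)).2
      rw [norm_eq_abs, abs_le]
      constructor <;> linarith [exp_pos (F n x)]
    · filter_upwards [hμ] with x hx
      exact ((continuous_exp.tendsto _).comp hx).sub_const 1

theorem continuous_entropyDual [TopologicalSpace X] [OpensMeasurableSpace X] (μ : Measure X)
    (f : X →ᵇ ℝ) : Continuous fun ν : FiniteMeasure X => entropyDual (ν : Measure X) μ f :=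
  (FiniteMeasure.continuous_integral_boundedContinuousFunction f).sub continuous_const

variable [TopologicalSpace X] [TopologicalSpace.PseudoMetrizableSpace X] [BorelSpace X]

theorem exists_seq_boundedContinuous_tendsto_ae {M : ℝ} (hf : AEStronglyMeasurable f ν)
    (hM : ∀ x, |f x| ≤ M) :
    ∃ g : ℕ → X →ᵇ ℝ, (∀ n x, |g n x| ≤ M) ∧
      ∀ᵐ x ∂ν, Tendsto (fun n => g n x) atTop (𝓝 (f x)) := by
  have h_approx (n : ℕ) : ∃ g : X →ᵇ ℝ, eLpNorm ((g : X → ℝ) - f) 1 ν ≤ ((n : ℝ≥0∞) + 1)⁻¹ := by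
    obtain ⟨g, hg, -⟩ := (MemLp.of_bound (p := 1) hf M
      (ae_of_all _ hM)).exists_boundedContinuous_eLpNorm_sub_le ENNReal.one_ne_top
      (ENNReal.inv_ne_zero.2 (by finiteness : (n : ℝ≥0∞) + 1 ≠ ∞))
    exact ⟨g, by rwa [eLpNorm_sub_comm]⟩
  choose g hg using h_approx
  have h_lim : Tendsto (fun n => eLpNorm ((g n : X → ℝ) - f) 1 ν) atTop (𝓝 0) := by
    refine tendsto_of_tendsto_of_tendsto_of_le_of_le tendsto_const_nhds ?_ (fun _ => zero_le) hg
    exact_mod_cast ENNReal.tendsto_inv_nat_nhds_zero.comp (tendsto_add_atTop_nat 1)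
  obtain ⟨ns, -, h_ae⟩ := (tendstoInMeasure_of_tendsto_eLpNorm one_ne_zero
    (fun n => (g n).continuous.aestronglyMeasurable) hf h_lim).exists_seq_tendsto_ae
  refine ⟨fun n => .const X (-M) ⊔ (.const X M ⊓ g (ns n)), fun n x => ?_, ?_⟩
  · have hM0 : 0 ≤ M := (abs_nonneg _).trans (hM x)
    exact abs_le.2 ⟨le_max_left _ _, max_le (by simpa using hM0) (min_le_left _ _)⟩
  · filter_upwards [h_ae] with x hx
    have h_clamp : max (-M) (min M (f x)) = f x := by
      rw [min_eq_right (abs_le.1 (hM x)).2, max_eq_right (abs_le.1 (hM x)).1]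
    rw [← h_clamp]
    exact tendsto_const_nhds.max (tendsto_const_nhds.min hx)

theorem klDiv_eq_iSup_entropyDual (ν μ : Measure X) [IsFiniteMeasure ν] [IsFiniteMeasure μ] :
    klDiv ν μ = ⨆ f : X →ᵇ ℝ, ENNReal.ofReal (entropyDual ν μ f) := by
  refine le_antisymm ?_ (iSup_le fun f => ofReal_entropyDual_le_klDiv (f.integrable ν) ?_)
  · refine klDiv_le_of_forall_bounded_entropyDual_le fun f M hf hM => ?_
    obtain ⟨g, hgM, hg⟩ :=
      exists_seq_boundedContinuous_tendsto_ae (ν := ν + μ) hf.aestronglyMeasurable hM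
    have h_lim : Tendsto (fun n => entropyDual ν μ (g n)) atTop (𝓝 (entropyDual ν μ f)) :=
      tendsto_entropyDual_of_tendsto_ae (fun n => (g n).continuous.measurable) hgM
        (ae_add_measure_iff.1 hg).1 (ae_add_measure_iff.1 hg).2
    exact le_of_tendsto' (ENNReal.tendsto_ofReal h_lim) fun n => le_iSup_of_le (g n) le_rfl
  · exact integrable_exp_of_abs_le f.continuous.aestronglyMeasurable f.norm_coe_le_norm

theorem lowerSemicontinuous_klDiv (μ : Measure X) [IsFiniteMeasure μ] :
    LowerSemicontinuous fun ν : FiniteMeasure X => klDiv (ν : Measure X) μ := by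
  simp only [klDiv_eq_iSup_entropyDual]
  exact lowerSemicontinuous_iSup fun f =>
    (ENNReal.continuous_ofReal.comp (continuous_entropyDual μ f)).lowerSemicontinuous

theorem lowerSemicontinuous_klDiv_probabilityMeasure (μ : Measure X) [IsFiniteMeasure μ] :
    LowerSemicontinuous fun ν : ProbabilityMeasure X => klDiv (ν : Measure X) μ :=
  (lowerSemicontinuous_klDiv μ).comp ProbabilityMeasure.toFiniteMeasure_continuous

end DonskerVaradhan

/-! ### Sanov's upper bound -/

section Sanov

variable {Ω X : Type*} [MeasurableSpace Ω] [MeasurableSpace X] {P : Measure Ω}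
  {μ : ProbabilityMeasure X} {Y : ℕ → Ω → X}

theorem integral_empirical {f : X → ℝ} (hf : StronglyMeasurable f) (n : ℕ+) (y : ℕ → X) :
    ∫ x, f x ∂(empirical n y : Measure X) = (∑ i ∈ Finset.range n, f (y i)) / n := by
  have h_coe : (empirical n y : Measure X) =
      ((n : ℕ) : ℝ≥0∞)⁻¹ • ∑ i ∈ Finset.range n, Measure.dirac (y i) := rfl
  rw [h_coe, integral_smul_measure,
    integral_finsetSum_measure fun i _ => integrable_dirac' hf (by simp)]
  simp [integral_dirac' f _ hf, div_eq_inv_mul]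

theorem IsIIDSample.measureReal_le_sum_le (hY : IsIIDSample P μ Y) {g : X → ℝ}
    (hg : Measurable g) (hexp : Integrable (fun x => exp (g x)) (μ : Measure X)) (n : ℕ) (a : ℝ) :
    P.real {ω | a ≤ ∑ i ∈ Finset.range n, g (Y i ω)}
      ≤ exp (-a) * (∫ x, exp (g x) ∂(μ : Measure X)) ^ n := by
  have : IsProbabilityMeasure P := hY.indep.isProbabilityMeasure
  have hZ (i : ℕ) : Measurable (g ∘ Y i) := hg.comp (hY.measurable i)
  have h_indep : iIndepFun (fun i => g ∘ Y i) P := hY.indep.comp _ fun _ => hg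
  have h_int (i : ℕ) : Integrable (fun ω => exp (1 * (g ∘ Y i) ω)) P := by
    simpa only [one_mul] using (hY.law i ▸ hexp).comp_measurable (hY.measurable i)
  have h_mgf (i : ℕ) : mgf (g ∘ Y i) P 1 = ∫ x, exp (g x) ∂(μ : Measure X) := by
    rw [← hY.law i, integral_map (hY.measurable i).aemeasurable hg.exp.aestronglyMeasurable]
    simp only [mgf, one_mul, Function.comp_apply]
  have h_chernoff := measure_ge_le_exp_mul_mgf a zero_le_one
    (h_indep.integrable_exp_mul_sum hZ (s := Finset.range n) fun i _ => h_int i)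
  rwa [h_indep.mgf_sum hZ, Finset.prod_congr rfl fun i _ => h_mgf i, Finset.prod_const,
    Finset.card_range, neg_one_mul, Finset.sum_fn] at h_chernoff

theorem IsIIDSample.measureReal_le_entropyDual_empirical_le (hY : IsIIDSample P μ Y) {f : X → ℝ}
    (hf : Measurable f) (hexp : Integrable (fun x => exp (f x)) (μ : Measure X)) (n : ℕ+)
    (c : ℝ) :
    P.real {ω | c ≤ entropyDual (empirical n fun i => Y i ω : Measure X) μ f}
      ≤ exp (-c * n) := by
  set b : ℝ := ∫ x, (exp (f x) - 1) ∂(μ : Measure X) with hb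
  have h_exp_le : ∫ x, exp (f x) ∂(μ : Measure X) ≤ exp b := by
    have h_eq : b = ∫ x, exp (f x) ∂(μ : Measure X) - 1 := by
      rw [hb, integral_sub hexp (integrable_const 1)]
      simp
    linarith [add_one_le_exp b]
  have h_set : {ω | c ≤ entropyDual (empirical n fun i => Y i ω : Measure X) μ f}
      = {ω | n * (c + b) ≤ ∑ i ∈ Finset.range n, f (Y i ω)} := by
    ext ω
    have hn : (0 : ℝ) < n := mod_cast n.pos
    rw [mem_ofPred_eq, mem_ofPred_eq, entropyDual, integral_empirical hf.stronglyMeasurable, ← hb,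
      le_sub_iff_add_le, le_div_iff₀' hn]
  calc P.real {ω | c ≤ entropyDual (empirical n fun i => Y i ω : Measure X) μ f}
      ≤ exp (-(n * (c + b))) * (∫ x, exp (f x) ∂(μ : Measure X)) ^ (n : ℕ) :=
        h_set ▸ hY.measureReal_le_sum_le hf hexp n _
    _ ≤ exp (-(n * (c + b))) * exp b ^ (n : ℕ) := by gcongr
    _ = exp (-c * n) := by
        rw [← exp_nat_mul, ← exp_add]
        ring_nf

theorem limsup_log_le_neg_of_le_mul_exp {u : ℕ+ → ℝ≥0∞} {N c : ℝ} (hN : 0 < N)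
    (h : ∀ n : ℕ+, u n ≤ ENNReal.ofReal (N * exp (-c * n))) :
    limsup (fun n : ℕ+ => ((1 / (n : ℝ) : ℝ) : EReal) * ENNReal.log (u n)) atTop
      ≤ ((-c : ℝ) : EReal) := by
  have h_lim : Tendsto (fun n : ℕ+ => ((1 / (n : ℝ) * log N - c : ℝ) : EReal)) atTop
      (𝓝 ((-c : ℝ) : EReal)) := by
    refine (continuous_coe_real_ereal.tendsto _).comp ?_
    have h_inv : Tendsto (fun n : ℕ+ => 1 / ((n : ℕ) : ℝ)) atTop (𝓝 0) :=
      tendsto_one_div_atTop_nhds_zero_nat.comp tendsto_PNat_val_atTop_atTop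
    simpa using (h_inv.mul_const (log N)).sub_const c
  rw [← h_lim.limsup_eq]
  refine limsup_le_limsup (Eventually.of_forall fun n => ?_)
  have hpos : 0 < N * exp (-c * n) := by positivity
  calc ((1 / (n : ℝ) : ℝ) : EReal) * ENNReal.log (u n)
      ≤ ((1 / (n : ℝ) : ℝ) : EReal) * (log (N * exp (-c * n)) : ℝ) := by
        refine mul_le_mul_of_nonneg_left ?_ (EReal.coe_nonneg.2 (by positivity))
        rw [← ENNReal.log_ofReal_of_pos hpos]
        exact ENNReal.log_le_log (h n)
    _ = ((1 / (n : ℝ) * log N - c : ℝ) : EReal) := by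
        rw [← EReal.coe_mul, log_mul hN.ne' (exp_pos _).ne', log_exp]
        congr 1
        field

variable [TopologicalSpace X] [OpensMeasurableSpace X] {K : Set (ProbabilityMeasure X)}

theorem IsIIDSample.measureReal_empirical_mem_le_card_mul_exp (hY : IsIIDSample P μ Y) {c : ℝ}
    {t : Finset (X →ᵇ ℝ)} (ht : ∀ ν ∈ K, ∃ f ∈ t, c < entropyDual (ν : Measure X) μ f) (n : ℕ+) :
    P.real {ω | empirical n (fun i => Y i ω) ∈ K} ≤ t.card * exp (-c * n) := by
  have : IsProbabilityMeasure P := hY.indep.isProbabilityMeasure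
  calc P.real {ω | empirical n (fun i => Y i ω) ∈ K}
      ≤ P.real (⋃ f ∈ t, {ω | c ≤ entropyDual (empirical n fun i => Y i ω : Measure X) μ f}) := by
        refine measureReal_mono (fun ω hω => ?_) (measure_ne_top _ _)
        obtain ⟨f, hft, hlt⟩ := ht _ hω
        exact mem_iUnion₂.2 ⟨f, hft, hlt.le⟩
    _ ≤ ∑ _ ∈ t, exp (-c * n) :=
        (measureReal_biUnion_finset_le _ _).trans <| Finset.sum_le_sum fun f _ =>
          hY.measureReal_le_entropyDual_empirical_le f.continuous.measurable
            (integrable_exp_of_abs_le f.continuous.measurable.aestronglyMeasurable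
              f.norm_coe_le_norm) n c
    _ = t.card * exp (-c * n) := by rw [Finset.sum_const, nsmul_eq_mul]

end Sanov

section SanovCompact

variable {X : Type*} [TopologicalSpace X] [TopologicalSpace.PseudoMetrizableSpace X]
  [MeasurableSpace X] [BorelSpace X] {K : Set (ProbabilityMeasure X)}

theorem exists_finset_forall_lt_entropyDual (μ : Measure X) [IsFiniteMeasure μ] (hK : IsCompact K)
    {c : ℝ} (h : ∀ ν ∈ K, ENNReal.ofReal c < klDiv (ν : Measure X) μ) :
    ∃ t : Finset (X →ᵇ ℝ), ∀ ν ∈ K, ∃ f ∈ t, c < entropyDual (ν : Measure X) μ f := by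
  have h_cover : K ⊆ ⋃ f : X →ᵇ ℝ, {ν | c < entropyDual (ν : Measure X) μ f} := by
    intro ν hν
    obtain ⟨f, hf⟩ := lt_iSup_iff.1 (klDiv_eq_iSup_entropyDual (ν : Measure X) μ ▸ h ν hν)
    exact mem_iUnion.2 ⟨f, (ENNReal.ofReal_lt_ofReal_iff'.1 hf).1⟩
  obtain ⟨t, ht⟩ := hK.elim_finite_subcover _ (fun f : X →ᵇ ℝ =>
    isOpen_lt continuous_const ((continuous_entropyDual μ f).comp
      ProbabilityMeasure.toFiniteMeasure_continuous)) h_cover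
  exact ⟨t, fun ν hν => by simpa using ht hν⟩

theorem exists_measureReal_empirical_mem_le_mul_exp (μ : ProbabilityMeasure X) (hK : IsCompact K)
    {c : ℝ} (h : ∀ ν ∈ K, ENNReal.ofReal c < klDiv (ν : Measure X) μ) :
    ∃ N : ℝ, 0 < N ∧ ∀ (Ω : Type*) [MeasurableSpace Ω] (P : Measure Ω) (Y : ℕ → Ω → X),
      IsIIDSample P μ Y → ∀ n : ℕ+,
        P.real {ω | empirical n (fun i => Y i ω) ∈ K} ≤ N * exp (-c * n) := by
  obtain ⟨t, ht⟩ := exists_finset_forall_lt_entropyDual (μ : Measure X) hK h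
  refine ⟨t.card + 1, by positivity, fun Ω _ P Y hY n => ?_⟩
  refine (hY.measureReal_empirical_mem_le_card_mul_exp ht n).trans ?_
  gcongr
  exact le_add_of_nonneg_right zero_le_one

theorem exists_measureReal_empirical_mem_le_mul_exp_of_notMem {μ : ProbabilityMeasure X}
    (hK : IsCompact K) (hμ : μ ∉ K) :
    ∃ c₁ c₂ : ℝ, 0 < c₁ ∧ 0 < c₂ ∧
      ∀ (Ω : Type*) [MeasurableSpace Ω] (P : Measure Ω) (Y : ℕ → Ω → X),
        IsIIDSample P μ Y → ∀ n : ℕ+,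
          P.real {ω | empirical n (fun i => Y i ω) ∈ K} ≤ c₁ * exp (-c₂ * n) := by
  obtain ⟨c, hc_pos, hc⟩ : ∃ c : ℝ, 0 < c ∧
      ∀ ν ∈ K, ENNReal.ofReal c < klDiv (ν : Measure X) (μ : Measure X) := by
    rcases K.eq_empty_or_nonempty with rfl | hne
    · exact ⟨1, one_pos, by simp⟩
    obtain ⟨ν, hν, h_min⟩ := ((lowerSemicontinuous_klDiv_probabilityMeasure
      (μ : Measure X)).lowerSemicontinuousOn K).exists_isMinOn hne hK
    have h_pos : 0 < klDiv (ν : Measure X) (μ : Measure X) := by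
      refine pos_iff_ne_zero.2 fun h_zero => hμ ?_
      have h_eq : (ν : Measure X) = μ := klDiv_eq_zero_iff.1 h_zero
      rwa [← Subtype.ext h_eq]
    obtain ⟨c, -, hc⟩ := ENNReal.lt_iff_exists_real_btwn.1 h_pos
    exact ⟨c, ENNReal.ofReal_pos.1 hc.1, fun ν' hν' => hc.2.trans_le (h_min hν')⟩
  obtain ⟨N, hN, h_bound⟩ := exists_measureReal_empirical_mem_le_mul_exp μ hK hc
  exact ⟨N, c, hN, hc_pos, h_bound⟩

theorem IsIIDSample.limsup_log_empirical_mem_le {Ω : Type*} [MeasurableSpace Ω] {P : Measure Ω}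
    {μ : ProbabilityMeasure X} {Y : ℕ → Ω → X} (hY : IsIIDSample P μ Y) (hK : IsCompact K) :
    limsup (fun n : ℕ+ => ((1 / (n : ℝ) : ℝ) : EReal) *
        ENNReal.log (P {ω | empirical n (fun i => Y i ω) ∈ K})) atTop
      ≤ -((⨅ ν ∈ K, klDiv (ν : Measure X) μ : ℝ≥0∞) : EReal) := by
  have : IsProbabilityMeasure P := hY.indep.isProbabilityMeasure
  set L : EReal := limsup (fun n : ℕ+ => ((1 / (n : ℝ) : ℝ) : EReal) *
    ENNReal.log (P {ω | empirical n (fun i => Y i ω) ∈ K})) atTop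
  have hL : 0 ≤ -L := by
    have h_le : L ≤ ((-0 : ℝ) : EReal) :=
      limsup_log_le_neg_of_le_mul_exp one_pos fun n => by simpa using prob_le_one
    rwa [EReal.le_neg, ← EReal.coe_zero, ← EReal.coe_neg]
  rw [EReal.le_neg, ← EReal.coe_toENNReal hL, EReal.coe_ennreal_le_coe_ennreal_iff]
  refine ENNReal.le_of_forall_nnreal_lt fun c hc => ?_
  obtain ⟨N, hN, h_bound⟩ := exists_measureReal_empirical_mem_le_mul_exp μ hK (c := c)
    fun ν hν => by simpa using hc.trans_le (iInf₂_le ν hν)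
  rw [← EReal.coe_ennreal_le_coe_ennreal_iff, EReal.coe_toENNReal hL, EReal.le_neg]
  refine limsup_log_le_neg_of_le_mul_exp hN fun n => ?_
  rw [ENNReal.le_ofReal_iff_toReal_le (measure_ne_top _ _) (by positivity)]
  exact h_bound Ω P Y hY n

end SanovCompact

/-! ### The Hausdorff upper topology -/

section UpperTopology

variable {X : Type*} [MetricSpace X]

theorem rho_lt_iff_subset_thickening {C D : HyperK X} {ε : ℝ} :
    rho C D < ε ↔ (C : Set X) ⊆ Metric.thickening ε (D : Set X) := by
  rw [rho, C.isCompact.sSup_lt_iff_of_continuous C.nonempty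
    (Metric.continuous_infDist_pt _).continuousOn]
  exact forall₂_congr fun _ _ => (Metric.mem_thickening_iff_infDist_lt D.nonempty).symm

theorem mem_of_isOpen_of_subset {U : Set (HyperK X)} (hU : IsOpen U) {C D : HyperK X}
    (hCD : (C : Set X) ⊆ D) (hD : D ∈ U) : C ∈ U := by
  obtain ⟨ε, hε, h_ball⟩ := hU D hD
  exact h_ball C <| rho_lt_iff_subset_thickening.2 <|
    hCD.trans (Metric.self_subset_thickening hε _)

theorem isCompact_setOf_exists_subset {S : Set (HyperK X)} (hS : IsCompact S) :
    IsCompact {C : HyperK X | ∃ D ∈ S, (C : Set X) ⊆ D} := by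
  refine isCompact_of_finite_subcover fun U hU h_cover => ?_
  obtain ⟨t, ht⟩ := hS.elim_finite_subcover U hU fun D hD => h_cover ⟨D, hD, Subset.rfl⟩
  refine ⟨t, fun C ⟨D, hD, hCD⟩ => ?_⟩
  obtain ⟨i, hi, hDi⟩ := mem_iUnion₂.1 (ht hD)
  exact mem_iUnion₂.2 ⟨i, hi, mem_of_isOpen_of_subset (hU i) hCD hDi⟩

variable {Z : Type*} [TopologicalSpace Z] [CompactSpace X] {F : Z → HyperK X}

theorem isOpen_setOf_subset_of_isClosed_graph
    (hF : IsClosed {q : Z × X | q.2 ∈ (F q.1 : Set X)}) {V : Set X} (hV : IsOpen V) :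
    IsOpen {z | (F z : Set X) ⊆ V} := by
  have h_image : {z | (F z : Set X) ⊆ V} =
      (Prod.fst '' ({q : Z × X | q.2 ∈ (F q.1 : Set X)} ∩ Prod.snd ⁻¹' Vᶜ))ᶜ := by
    ext z
    simp [subset_def]
  rw [h_image]
  exact (isClosedMap_fst_of_compactSpace _
    (hF.inter (hV.isClosed_compl.preimage continuous_snd))).isOpen_compl

theorem continuous_of_isClosed_graph
    (hF : IsClosed {q : Z × X | q.2 ∈ (F q.1 : Set X)}) : Continuous F := by
  refine continuous_iff_continuousAt.2 fun z => tendsto_nhds.2 fun U hU hzU => ?_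
  obtain ⟨ε, hε, h_ball⟩ := hU _ hzU
  have h_open := isOpen_setOf_subset_of_isClosed_graph hF
    (Metric.isOpen_thickening (δ := ε) (E := (F z : Set X)))
  filter_upwards [h_open.mem_nhds (Metric.self_subset_thickening hε _)] with z' hz'
  exact h_ball _ (rho_lt_iff_subset_thickening.2 hz')

end UpperTopology

/-! ### Fréchet means -/

section WeakTopology

variable {X : Type*} [TopologicalSpace X] [MeasurableSpace X] [OpensMeasurableSpace X]

theorem continuous_integral_prod_boundedContinuousFunction :
    Continuous fun q : ProbabilityMeasure X × (X →ᵇ ℝ) => ∫ x, q.2 x ∂(q.1 : Measure X) := by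
  refine continuous_prod_of_continuous_lipschitzWith' _ 1 (fun ν => ?_)
    ProbabilityMeasure.continuous_integral_boundedContinuousFunction
  refine LipschitzWith.of_dist_le_mul fun f g => ?_
  rw [NNReal.coe_one, one_mul, dist_eq_norm, dist_eq_norm,
    ← integral_sub (f.integrable _) (g.integrable _)]
  exact (f - g).norm_integral_le_norm (ν : Measure X)

end WeakTopology

section FrechetMean

variable {X : Type*} [MetricSpace X] [CompactSpace X] [MeasurableSpace X] [BorelSpace X]

theorem continuous_frechetFun_prod {p : ℝ} (hp : 0 ≤ p) :
    Continuous fun q : ProbabilityMeasure X × X => frechetFun p (q.1 : Measure X) q.2 := by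
  let D : C(X × X, ℝ) := ⟨fun q => dist q.1 q.2 ^ p, continuous_dist.rpow_const fun _ => .inr hp⟩
  have hD : Continuous fun x => BoundedContinuousFunction.mkOfCompact (D.curry x) :=
    (ContinuousMap.isometryEquivBoundedOfCompact X ℝ).continuous.comp D.curry.continuous
  exact continuous_integral_prod_boundedContinuousFunction.comp
    (continuous_fst.prodMk (hD.comp continuous_snd))

variable {p : ℝ} (hp : 1 ≤ p)

theorem mem_frechetMean {ν : ProbabilityMeasure X} {x : X} :
    x ∈ (frechetMean p hp ν : Set X) ↔
      ∀ x', frechetFun p (ν : Measure X) x ≤ frechetFun p (ν : Measure X) x' :=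
  Iff.rfl

theorem isClosed_graph_frechetMean :
    IsClosed {q : ProbabilityMeasure X × X | q.2 ∈ (frechetMean p hp q.1 : Set X)} := by
  have h_cont := continuous_frechetFun_prod (X := X) (zero_le_one.trans hp)
  simp only [mem_frechetMean, ofPred_forall]
  exact isClosed_iInter fun x' =>
    isClosed_le h_cont (h_cont.comp (continuous_fst.prodMk continuous_const))

theorem continuous_frechetMean :
    Continuous (frechetMean p hp : ProbabilityMeasure X → HyperK X) :=
  continuous_of_isClosed_graph (isClosed_graph_frechetMean hp)

theorem isClosed_setOf_subset_frechetMean (s : Set X) :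
    IsClosed {ν : ProbabilityMeasure X | s ⊆ (frechetMean p hp ν : Set X)} := by
  simp only [subset_def, ofPred_forall]
  exact isClosed_biInter fun x _ =>
    (isClosed_graph_frechetMean hp).preimage (continuous_id.prodMk continuous_const)

theorem rateFun_frechetMean_le (μ ν : ProbabilityMeasure X) :
    rateFun p hp μ (frechetMean p hp ν) ≤ klDiv (ν : Measure X) (μ : Measure X) :=
  iInf₂_le ν Subset.rfl

theorem rateFun_le_iff (μ : ProbabilityMeasure X) (C : HyperK X) {α : ℝ≥0∞} (hα : α ≠ ∞) :
    rateFun p hp μ C ≤ α ↔ ∃ ν : ProbabilityMeasure X,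
      klDiv (ν : Measure X) (μ : Measure X) ≤ α ∧ (C : Set X) ⊆ (frechetMean p hp ν : Set X) := by
  refine ⟨fun h => ?_, fun ⟨ν, hν, hC⟩ => (iInf₂_le ν hC).trans hν⟩
  let S : Set (ProbabilityMeasure X) := {ν | (C : Set X) ⊆ (frechetMean p hp ν : Set X)}
  have h_nonempty : S.Nonempty := by
    by_contra h_empty
    exact hα (top_le_iff.1 (h.trans' (le_iInf₂ fun ν hν => (h_empty ⟨ν, hν⟩).elim)))
  obtain ⟨ν, hν, h_min⟩ := ((lowerSemicontinuous_klDiv_probabilityMeasure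
    (μ : Measure X)).lowerSemicontinuousOn S).exists_isMinOn h_nonempty
      (isClosed_setOf_subset_frechetMean hp _).isCompact
  exact ⟨ν, (le_iInf₂ fun ν' hν' => h_min hν').trans h, hν⟩

theorem isCompact_setOf_rateFun_le (μ : ProbabilityMeasure X) (α : ℝ≥0∞) :
    IsCompact {C : HyperK X | rateFun p hp μ C ≤ α} := by
  rcases eq_or_ne α ∞ with rfl | hα
  · have : Nonempty X := μ.nonempty
    let T : HyperK X := (⊤ : TopologicalSpace.NonemptyCompacts X)
    have h_top (C : HyperK X) : (C : Set X) ⊆ T := fun x _ => mem_univ x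
    simpa [h_top] using isCompact_setOf_exists_subset (isCompact_singleton (x := T))
  · have h_compact : IsCompact {ν : ProbabilityMeasure X | klDiv (ν : Measure X) μ ≤ α} :=
      ((lowerSemicontinuous_klDiv_probabilityMeasure _).isClosed_preimage α).isCompact
    simpa only [rateFun_le_iff hp μ _ hα, exists_mem_image, mem_ofPred_eq] using
      isCompact_setOf_exists_subset (h_compact.image (continuous_frechetMean hp))

theorem IsIIDSample.limsup_log_frechetMean_mem_le {Ω : Type*} [MeasurableSpace Ω] {P : Measure Ω}
    {μ : ProbabilityMeasure X} {Y : ℕ → Ω → X} (hY : IsIIDSample P μ Y) (A : Set (HyperK X)) :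
    limsup (fun n : ℕ+ => ((1 / (n : ℝ) : ℝ) : EReal) *
        ENNReal.log (P {ω | frechetMean p hp (empirical n fun i => Y i ω) ∈ A})) atTop
      ≤ -((⨅ C ∈ closure A, rateFun p hp μ C : ℝ≥0∞) : EReal) := by
  let K : Set (ProbabilityMeasure X) := frechetMean p hp ⁻¹' closure A
  have hK : IsCompact K := (isClosed_closure.preimage (continuous_frechetMean hp)).isCompact
  have h_inf : ⨅ C ∈ closure A, rateFun p hp μ C ≤ ⨅ ν ∈ K, klDiv (ν : Measure X) μ :=
    le_iInf₂ fun ν hν => (iInf₂_le (frechetMean p hp ν) hν).trans (rateFun_frechetMean_le hp μ ν)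
  calc limsup (fun n : ℕ+ => ((1 / (n : ℝ) : ℝ) : EReal) *
        ENNReal.log (P {ω | frechetMean p hp (empirical n fun i => Y i ω) ∈ A})) atTop
      ≤ limsup (fun n : ℕ+ => ((1 / (n : ℝ) : ℝ) : EReal) *
          ENNReal.log (P {ω | empirical n (fun i => Y i ω) ∈ K})) atTop := by
        refine limsup_le_limsup (Eventually.of_forall fun n => ?_)
        refine mul_le_mul_of_nonneg_left (ENNReal.log_le_log (measure_mono fun ω hω => ?_))
          (EReal.coe_nonneg.2 (by positivity))
        exact subset_closure hω
    _ ≤ -((⨅ ν ∈ K, klDiv (ν : Measure X) μ : ℝ≥0∞) : EReal) :=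
        hY.limsup_log_empirical_mem_le hK
    _ ≤ -((⨅ C ∈ closure A, rateFun p hp μ C : ℝ≥0∞) : EReal) :=
        EReal.neg_le_neg_iff.2 (EReal.coe_ennreal_le_coe_ennreal_iff.2 h_inf)

theorem exists_measureReal_le_rho_frechetMean_le_mul_exp (μ : ProbabilityMeasure X) {ε : ℝ}
    (hε : 0 < ε) : ∃ c₁ c₂ : ℝ, 0 < c₁ ∧ 0 < c₂ ∧
      ∀ (Ω : Type*) [MeasurableSpace Ω] (P : Measure Ω) (Y : ℕ → Ω → X),
        IsIIDSample P μ Y → ∀ n : ℕ+,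
          P.real {ω | ε ≤ rho (frechetMean p hp (empirical n fun i => Y i ω))
            (frechetMean p hp μ)} ≤ c₁ * exp (-c₂ * n) := by
  have h_closed : IsClosed {C : HyperK X | ε ≤ rho C (frechetMean p hp μ)} := by
    simpa only [compl_ofPred, not_lt] using (isOpen_rho_ball (frechetMean p hp μ) ε).isClosed_compl
  refine exists_measureReal_empirical_mem_le_mul_exp_of_notMem
    (h_closed.preimage (continuous_frechetMean hp)).isCompact ?_
  simpa [rho_self] using hε

end FrechetMean

end FrechetLDP


theorem mainTheorem6 {X : Type*} [MetricSpace X] [CompactSpace X] [MeasurableSpace X]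
    [BorelSpace X] (p : ℝ) (hp : 1 ≤ p) (μ : ProbabilityMeasure X) :
    -- compact sublevel sets in the Hausdorff upper topology
    (∀ α : ℝ≥0∞, IsCompact {C : HyperK X | rateFun p hp μ C ≤ α}) ∧
    -- the large deviations upper bound
    (∀ (Ω : Type*) [MeasurableSpace Ω] (P : Measure Ω) [IsProbabilityMeasure P]
        (Y : ℕ → Ω → X), IsIIDSample P μ Y →
      ∀ A : Set (HyperK X), MeasurableSet[borel (HyperK X)] A →
        limsup (fun n : ℕ+ => ((1 / (n : ℝ) : ℝ) : EReal) *
            ENNReal.log (P {ω | frechetMean p hp (empirical n fun i => Y i ω) ∈ A})) atTop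
          ≤ -((⨅ C ∈ closure A, rateFun p hp μ C : ℝ≥0∞) : EReal)) ∧
    -- exponential decay, with constants that depend on `X`, `μ`, `p` and `ε` only
    (∀ ε : ℝ, 0 < ε → ∃ c₁ c₂ : ℝ, 0 < c₁ ∧ 0 < c₂ ∧
      ∀ (Ω : Type*) [MeasurableSpace Ω] (P : Measure Ω) [IsProbabilityMeasure P]
        (Y : ℕ → Ω → X), IsIIDSample P μ Y →
        ∀ n : ℕ+, P.real {ω | ε ≤ rho (frechetMean p hp (empirical n fun i => Y i ω))
            (frechetMean p hp μ)} ≤ c₁ * Real.exp (-c₂ * n)) :=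
  ⟨isCompact_setOf_rateFun_le hp μ,
    fun _ _ _ _ _ hY A _ => hY.limsup_log_frechetMean_mem_le hp A,
    fun _ hε =>
      let ⟨c₁, c₂, hc₁, hc₂, h_decay⟩ := exists_measureReal_le_rho_frechetMean_le_mul_exp hp μ hε
      ⟨c₁, c₂, hc₁, hc₂, fun Ω _ P _ => h_decay Ω P⟩⟩
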